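/- Let $n\in\mathbb N$ and let $B=[b_1,\dots,b_n]$ be a dual HKZ-basis of a full-rank lattice $\mathcal L=\mathcal L(b_1,\dots,b_n)\subset\mathbb R^n$ (Euclidean norm), with Gram--Schmidt vectors $b_1^*,\dots,b_n^*$. Here a basis $[d_1,\dots,d_n]$ is called HKZ-reduced if $\langle d_i,d_j^*\rangle/\langle d_j^*,d_j^*\rangle\le\frac12$ for all $j<i$ (in particular this holds if the absolute values are at most $\frac12$), and if for every $i$ the norm $\|d_i^*\|$ is the minimal norm of a nonzero vector of $\pi_i(\mathcal L(d_1,\dots,d_n))$, where $\pi_i$ is the orthogonal projection onto $\mathrm{span}(d_1,\dots,d_{i-1})^\perp$. The basis $B$ is called a dual HKZ-basis if its reverse dual basis $[b_1^\times,\dots,b_n^\times]$, determined by $\langle b_i^\times,b_j\rangle=\delta_{i,n-j+1}$, is HKZ-reduced. Let $t\in\mathbb R^n$, let $v\in\mathcal L$ be a closest lattice vector to $t$, that is, $\|v-t\|\le\|w-t\|$ for all $w\in\mathcal L$, and write the error vector as $t-v=e_1b_1^*+\dots+e_nb_n^*$ with $e_1,\dots,e_n\in\mathbb R$. If $1\le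 i<k\le n$ and $|e_k|,\dots,|e_{i+1}|>\frac12$, then $$ e_i^2+\sum_{j=i+1}^{k} e_j^2\,\frac{\prod_{l=i}^{j-1}\frac{l^2}{4}}{\prod_{l=i+1}^{j}\left(\frac{l^2}{4}-\frac14\right)}\;\le\;\frac{\prod_{j=i}^{k}\frac{j^2}{4}}{\prod_{j=i+1}^{k}\left(\frac{j^2}{4}-\frac14\right)} . $$ All the weights of the $e_j^2$ and the right-hand side are positive, so this says that $(e_i,\dots,e_k)$ lies in an explicit non-degenerate $(k-i+1)$-dimensional ellipsoid. -/

import Mathlib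

namespace DualHKZ

noncomputable section

/-- The lattice `L(b_1, …, b_m)`: all integer linear combinations of the vectors of `b`. -/
def lattice {n m : ℕ} (b : Fin m → EuclideanSpace ℝ (Fin n)) :
    Submodule ℤ (EuclideanSpace ℝ (Fin n)) :=
  Submodule.span ℤ (Set.range b)

/-- The Gram-Schmidt vectors `b_1^*, …, b_m^*` (orthogonal, not normalised). -/
def gs {n m : ℕ} (b : Fin m → EuclideanSpace ℝ (Fin n)) (i : Fin m) :
    EuclideanSpace ℝ (Fin n) :=
  InnerProductSpace.gramSchmidt ℝ b i

/-- `π_i(L(b))`, where `π_i` is the orthogonal projection onto the orthogonal complement of the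
span of the basis vectors that precede `b_i`. -/
def projectedLattice {n m : ℕ} (b : Fin m → EuclideanSpace ℝ (Fin n)) (i : Fin m) :
    Set (EuclideanSpace ℝ (Fin n)) :=
  (fun x => (Submodule.span ℝ (b '' Set.Iio i))ᗮ.starProjection x) ''
    (lattice b : Set (EuclideanSpace ℝ (Fin n)))

/-- `r = λ_1(S)`: `r` is the minimal norm of a nonzero vector of `S`. -/
def IsFirstMinimum {n : ℕ} (S : Set (EuclideanSpace ℝ (Fin n))) (r : ℝ) : Prop :=
  IsLeast {s : ℝ | ∃ x ∈ S, x ≠ 0 ∧ ‖x‖ = s} r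

/-- HKZ-reduced basis. The size condition is one-sided; it is implied by the two-sided
condition `|⟨b_i, b_j^*⟩ / ⟨b_j^*, b_j^*⟩| ≤ 1/2`. -/
structure IsHKZ {n m : ℕ} (b : Fin m → EuclideanSpace ℝ (Fin n)) : Prop where
  linearIndependent : LinearIndependent ℝ b
  size_reduced : ∀ i j : Fin m, j < i →
    inner ℝ (b i) (gs b j) / inner ℝ (gs b j) (gs b j) ≤ 1 / 2
  norm_gs : ∀ i : Fin m, IsFirstMinimum (projectedLattice b i) ‖gs b i‖

/-- `d` is the reverse dual basis of `b`: it lies in the span of `b`, and (with indices counted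
from 1) `⟨d_i, b_j⟩ = 1` if `i = m - j + 1` and `0` otherwise. -/
def IsReverseDual {n m : ℕ} (b d : Fin m → EuclideanSpace ℝ (Fin n)) : Prop :=
  (∀ i, d i ∈ Submodule.span ℝ (Set.range b)) ∧
    ∀ i j, inner ℝ (d i) (b j) = if i = Fin.rev j then (1 : ℝ) else 0

/-- `b` is a dual HKZ-basis: it is linearly independent, and its (unique) reverse dual basis
is HKZ-reduced. -/
def IsDualHKZ {n m : ℕ} (b : Fin m → EuclideanSpace ℝ (Fin n)) : Prop :=
  LinearIndependent ℝ b ∧ ∃ d, IsReverseDual b d ∧ IsHKZ d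

/-- `v` is a closest vector to `t` in the lattice `L`. -/
def IsClosestVector {n : ℕ} (L : Submodule ℤ (EuclideanSpace ℝ (Fin n)))
    (t v : EuclideanSpace ℝ (Fin n)) : Prop :=
  v ∈ L ∧ ∀ w ∈ L, ‖v - t‖ ≤ ‖w - t‖

/-- The index `1, …, n` (counted from 1), as a real number, of an element of `Fin n`. -/
def idx {n : ℕ} (j : Fin n) : ℝ := ((j : ℕ) : ℝ) + 1

/-- The weight `∏_{l=i}^{j-1} l²/4 / ∏_{l=i+1}^{j} (l²/4 - 1/4)`, indices counted from 1. -/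
def weight {n : ℕ} (i j : Fin n) : ℝ :=
  (∏ l ∈ Finset.Ico i j, idx l ^ 2 / 4) / ∏ l ∈ Finset.Ioc i j, (idx l ^ 2 / 4 - 1 / 4)

/-- The bound `∏_{j=i}^{k} j²/4 / ∏_{j=i+1}^{k} (j²/4 - 1/4)`, indices counted from 1. -/
def bound {n : ℕ} (i k : Fin n) : ℝ :=
  (∏ j ∈ Finset.Icc i k, idx j ^ 2 / 4) / ∏ j ∈ Finset.Ioc i k, (idx j ^ 2 / 4 - 1 / 4)

end

end DualHKZ

/-! Write `β j = ‖b_j^*‖²`. The dual of the lattice generated by `b_1, …, b_p` is a projection of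
the lattice of the reverse dual basis, so HKZ-reduction bounds its first minimum below by `1 /
‖b_p^*‖`. Banaszczyk's transference theorem (`exists_norm_latVec_add_lt`, proved by Poisson
summation of Gaussians) then bounds the covering radius of that lattice by `(p / 2) ‖b_p^*‖`.

Rounding the coordinates `k, …, p + 1` and then covering with `b_1, …, b_p` gives a lattice point
that competes with the closest vector. Hence, for each `p` from `i` to `k`, `∑_{j ≤ k} e_j² β_j ≤
(p² / 4) β_p + (1 / 4) ∑_{p < j ≤ k} β_j` (`sum_sq_le_of_isClosestVector`).

These inequalities are linear in the unknown positive `β_j`. Eliminating `β_k, …, β_{i+1}` in turn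
(`ellipsoid_step`, `le_slack_of_covering`) leaves the ellipsoid. The conditions `|e_j| > 1/2` keep
the multipliers in the elimination nonnegative. -/

/-! ### Poisson summation on `ℝ^ι`. -/

open MeasureTheory in
/-- The integer translates of the half-open unit box tile space: an integrable function can be
integrated by summing its translates over the box. -/
theorem integral_box_tsum_translates {ι : Type*} [Fintype ι] {h : (ι → ℝ) → ℂ}
    (hh : Integrable h) :
    ∫ x in {x : ι → ℝ | ∀ i, x i ∈ Set.Ioc (0 : ℝ) (0 + 1)},
      ∑' m : ι → ℤ, h (x + fun i => (m i : ℝ)) = ∫ x, h x := by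
  set Q : (ι → ℤ) → Set (ι → ℝ) := fun m => {x | ∀ i, x i ∈ Set.Ioc (m i : ℝ) (m i + 1)} with hQ
  have hQm : ∀ m, MeasurableSet (Q m) := fun m =>
    MeasurableSet.univ_pi' fun i => measurableSet_Ioc
  -- The cells are open on the left, so the ceiling, not the floor, identifies the cell of a point.
  have hmem : ∀ m x, x ∈ Q m ↔ ∀ i, ⌈x i⌉ = m i + 1 := by
    intro m x
    refine forall_congr' fun i => ?_
    rw [Int.ceil_eq_iff]
    simp
  have hdisj : Pairwise (Function.onFun Disjoint Q) := by
    intro m m' hmm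
    refine Set.disjoint_left.2 fun x hx hx' => hmm (funext fun i => ?_)
    have h1 := (hmem m x).1 hx i
    have h2 := (hmem m' x).1 hx' i
    omega
  have hun : ⋃ m, Q m = Set.univ := by
    refine Set.eq_univ_of_forall fun x => Set.mem_iUnion.2 ⟨fun i => ⌈x i⌉ - 1, ?_⟩
    rw [hmem]
    intro i
    omega
  have htrans : ∀ {F : Type} [NormedAddCommGroup F] [NormedSpace ℝ F] (f : (ι → ℝ) → F)
      (m : ι → ℤ), ∫ x in Q m, f x = ∫ x in Q 0, f (x + fun i => (m i : ℝ)) := by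
    intro F _ _ f m
    have hmp := measurePreserving_add_right (volume : Measure (ι → ℝ)) (fun i => (m i : ℝ))
    rw [← hmp.setIntegral_preimage_emb (MeasurableEquiv.addRight _).measurableEmbedding f (Q m)]
    congr 2
    ext x
    refine forall_congr' fun i => ?_
    simp only [Pi.add_apply, Pi.zero_apply, Int.cast_zero, zero_add, Set.mem_Ioc]
    constructor <;> rintro ⟨h1, h2⟩ <;> constructor <;> linarith
  have hQ0 : {x : ι → ℝ | ∀ i, x i ∈ Set.Ioc (0 : ℝ) (0 + 1)} = Q 0 := by simp [hQ]
  have hs1 := hasSum_integral_iUnion (f := h) hQm hdisj hh.integrableOn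
  have hs2 := hasSum_integral_iUnion (f := fun x => ‖h x‖) hQm hdisj hh.norm.integrableOn
  simp only [htrans h] at hs1
  simp only [htrans (fun x => ‖h x‖)] at hs2
  rw [hun, setIntegral_univ] at hs1
  rw [hQ0]
  have hint : ∀ m : ι → ℤ, IntegrableOn (fun x => h (x + fun i => (m i : ℝ))) (Q 0) := fun m =>
    (hh.comp_add_right _).integrableOn
  exact (hasSum_integral_of_summable_integral_norm hint hs2.summable).unique hs1

/-- The character `x ↦ exp (2 π i ⟨m, x⟩)` of `ℝ^ι`. -/
noncomputable def piChar {ι : Type*} [Fintype ι] (m : ι → ℤ) (x : ι → ℝ) : ℂ :=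
  Complex.exp (2 * Real.pi * Complex.I * ((∑ i, (m i : ℝ) * x i : ℝ) : ℂ))

theorem mFourier_coe_eq_piChar {ι : Type*} [Fintype ι] (m : ι → ℤ) (x : ι → ℝ) :
    UnitAddTorus.mFourier m (fun i => (x i : UnitAddCircle)) = piChar m x := by
  simp only [UnitAddTorus.mFourier, ContinuousMap.coe_mk, fourier_coe_apply, piChar]
  rw [← Complex.exp_sum]
  congr 1
  push_cast
  rw [Finset.mul_sum]
  refine Finset.sum_congr rfl fun i _ => ?_
  ring

theorem norm_piChar {ι : Type*} [Fintype ι] (m : ι → ℤ) (x : ι → ℝ) : ‖piChar m x‖ = 1 := by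
  rw [piChar, show (2 * Real.pi * Complex.I * ((∑ i, (m i : ℝ) * x i : ℝ) : ℂ)) =
    ((2 * Real.pi * ∑ i, (m i : ℝ) * x i : ℝ) : ℂ) * Complex.I by push_cast; ring]
  exact Complex.norm_exp_ofReal_mul_I _

theorem continuous_piChar {ι : Type*} [Fintype ι] (m : ι → ℤ) : Continuous (piChar m) := by
  unfold piChar
  fun_prop

theorem piChar_add_int {ι : Type*} [Fintype ι] (m : ι → ℤ) (x : ι → ℝ) (k : ι → ℤ) :
    piChar m (x + fun i => (k i : ℝ)) = piChar m x := by
  rw [← mFourier_coe_eq_piChar, ← mFourier_coe_eq_piChar]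
  congr 1
  funext i
  simp only [Pi.add_apply, AddCircle.coe_add, add_eq_left]
  have : ((k i : ℤ) : ℝ) = k i • (1 : ℝ) := by simp
  rw [this, AddCircle.coe_zsmul, AddCircle.coe_period, smul_zero]

open MeasureTheory in
/-- **Poisson summation** on `ℝ^ι`. -/
theorem hasSum_poisson_pi {ι : Type*} [Fintype ι] {g : (ι → ℝ) → ℂ} (hg : Integrable g)
    (hF : Continuous fun x : ι → ℝ => ∑' m : ι → ℤ, g (x + fun i => (m i : ℝ)))
    (hs : Summable fun m : ι → ℤ => ∫ x, piChar (-m) x * g x) (x : ι → ℝ) :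
    HasSum (fun m : ι → ℤ => (∫ x, piChar (-m) x * g x) * piChar m x)
      (∑' m : ι → ℤ, g (x + fun i => (m i : ℝ))) := by
  set F : (ι → ℝ) → ℂ := fun x => ∑' m : ι → ℤ, g (x + fun i => (m i : ℝ)) with hFdef
  have hper : ∀ (x : ι → ℝ) (k : ι → ℤ), F (x + fun i => (k i : ℝ)) = F x := by
    intro x k
    simp only [hFdef]
    rw [← (Equiv.addLeft k).tsum_eq fun m : ι → ℤ => g (x + fun i => (m i : ℝ))]
    refine tsum_congr fun m => congrArg g (funext fun i => ?_)
    simp [add_assoc]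
  let π : (ι → ℝ) → UnitAddTorus ι := fun x i => (x i : UnitAddCircle)
  have hπ : IsOpenQuotientMap π :=
    IsOpenQuotientMap.piMap fun _ => QuotientAddGroup.isOpenQuotientMap_mk
  -- The periodization descends to the torus through an arbitrary section; periodicity makes the
  -- choice irrelevant, and the quotient topology gives continuity.
  let Φ : UnitAddTorus ι → ℂ := fun y => F (Function.surjInv hπ.surjective y)
  have hΦ : ∀ x, Φ (π x) = F x := by
    intro x
    have h1 : π (Function.surjInv hπ.surjective (π x)) = π x := Function.surjInv_eq _ _
    have h2 : ∀ i, ∃ k : ℤ, Function.surjInv hπ.surjective (π x) i = x i + k := by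
      intro i
      have h3 : ((Function.surjInv hπ.surjective (π x) i - x i : ℝ) : UnitAddCircle) = 0 := by
        rw [AddCircle.coe_sub]
        exact sub_eq_zero.2 (congrFun h1 i)
      obtain ⟨k, hk⟩ := (AddCircle.coe_eq_zero_iff 1).1 h3
      refine ⟨k, ?_⟩
      rw [zsmul_eq_mul, mul_one] at hk
      linarith
    choose k hk using h2
    have : Function.surjInv hπ.surjective (π x) = x + fun i => (k i : ℝ) := funext hk
    simp only [Φ, this, hper]
  have hΦc : Continuous Φ := by
    rw [hπ.isQuotientMap.continuous_iff]
    exact hF.congr fun x => (hΦ x).symm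
  let Ψ : C(UnitAddTorus ι, ℂ) := ⟨Φ, hΦc⟩
  have hcoef : ∀ m, UnitAddTorus.mFourierCoeff Ψ m = ∫ x, piChar (-m) x * g x := by
    intro m
    rw [UnitAddTorus.mFourierCoeff_eq_integral _ _ 0]
    -- Unfolding: the character is invariant under integer translations, so it can be moved inside
    -- the sum over translates.
    rw [← integral_box_tsum_translates (h := fun x => piChar (-m) x * g x)]
    · refine setIntegral_congr_fun (MeasurableSet.univ_pi' fun i => measurableSet_Ioc) fun x _ => ?_
      simp only [piChar_add_int, tsum_mul_left, mFourier_coe_eq_piChar, smul_eq_mul]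
      congr 1
      exact hΦ x
    · exact hg.bdd_mul (continuous_piChar _).aestronglyMeasurable
        (.of_forall fun x => (norm_piChar _ x).le)
  have hsum : Summable (UnitAddTorus.mFourierCoeff Ψ) := by
    rwa [show UnitAddTorus.mFourierCoeff Ψ = _ from funext hcoef]
  have := UnitAddTorus.hasSum_mFourier_series_apply_of_summable hsum (π x)
  simp only [hcoef, smul_eq_mul] at this
  have h5 : Ψ (π x) = F x := hΦ x
  rw [h5] at this
  refine this.congr_fun fun m => ?_
  rw [← mFourier_coe_eq_piChar]

/-! ### Gaussian sums over lattices and their theta series. -/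

/-- The real linear combination of the family `b` with integer coefficients `m`. -/
noncomputable def latVec {ι E : Type*} [Fintype ι] [AddCommGroup E] [Module ℝ E]
    (b : ι → E) (m : ι → ℤ) : E := ∑ j, (m j : ℝ) • b j

theorem latVec_eq_equivFun_symm {ι E : Type*} [Fintype ι] [AddCommGroup E] [Module ℝ E]
    (b : Module.Basis ι ℝ E) (m : ι → ℤ) :
    latVec b m = b.equivFun.symm fun j => (m j : ℝ) := by
  simp [latVec, Module.Basis.equivFun_symm_apply]

theorem latVec_injective {ι E : Type*} [Fintype ι] [AddCommGroup E] [Module ℝ E]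
    (b : Module.Basis ι ℝ E) : Function.Injective (latVec b : (ι → ℤ) → E) := by
  intro m m' h
  rw [latVec_eq_equivFun_symm, latVec_eq_equivFun_symm] at h
  funext j
  exact_mod_cast congrFun (b.equivFun.symm.injective h) j

theorem exists_exp_neg_mul_sq_le (N : ℕ) {c : ℝ} (hc : 0 < c) :
    ∃ C : ℝ, ∀ r : ℝ, 0 < r → Real.exp (-c * r ^ 2) ≤ C * (r ^ (2 * N))⁻¹ := by
  refine ⟨(N.factorial : ℝ) * (c ^ N)⁻¹, fun r hr => ?_⟩
  have h1 := Real.pow_div_factorial_le_exp (c * r ^ 2) (by positivity) N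
  rw [neg_mul, Real.exp_neg]
  have h2 : (N.factorial : ℝ) * (c ^ N)⁻¹ * (r ^ (2 * N))⁻¹ =
      ((c * r ^ 2) ^ N / N.factorial)⁻¹ := by
    rw [mul_pow, ← pow_mul, inv_div]
    field_simp
  rw [h2]
  exact inv_anti₀ (by positivity) h1

/-- From `‖x‖² ≤ 2‖x + u‖² + 2K²`. Halving the exponent makes the bound uniform for `u` in a ball,
which gives both summability and continuity of shifted Gaussian sums. -/
theorem exp_neg_norm_add_sq_le {E : Type*} [NormedAddCommGroup E] {c : ℝ} (hc : 0 ≤ c) (x u : E) {K : ℝ} (hK : ‖u‖ ≤ K) :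
    Real.exp (-c * ‖x + u‖ ^ 2) ≤ Real.exp (c * K ^ 2) * Real.exp (-(c / 2) * ‖x‖ ^ 2) := by
  rw [← Real.exp_add]
  refine Real.exp_le_exp.2 ?_
  have h1 : ‖x‖ ≤ ‖x + u‖ + ‖u‖ := by
    simpa using norm_sub_le (x + u) u
  have h2 : ‖x‖ ^ 2 ≤ 2 * ‖x + u‖ ^ 2 + 2 * K ^ 2 := by
    have h3 : ‖x‖ ^ 2 ≤ (‖x + u‖ + K) ^ 2 := by
      refine pow_le_pow_left₀ (norm_nonneg _) (by linarith) 2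
    nlinarith [sq_nonneg (‖x + u‖ - K)]
  nlinarith

section

variable {ι E : Type*} [Fintype ι] [NormedAddCommGroup E] [InnerProductSpace ℝ E]

theorem summable_norm_latVec_pow_inv (b : Module.Basis ι ℝ E) :
    ∃ N : ℕ, Summable fun m : ι → ℤ => (‖latVec b m‖ ^ (2 * N))⁻¹ := by
  have : FiniteDimensional ℝ E := b.finiteDimensional_of_finite
  obtain ⟨N, hN⟩ : ∃ N, Module.finrank ℤ (Submodule.span ℤ (Set.range b)) < 2 * N :=
    ⟨Module.finrank ℤ (Submodule.span ℤ (Set.range b)) + 1, by omega⟩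
  refine ⟨N, ?_⟩
  have h1 := ZLattice.summable_norm_pow_inv (L := Submodule.span ℤ (Set.range b)) (2 * N) hN
  have hmem : ∀ m : ι → ℤ, latVec b m ∈ Submodule.span ℤ (Set.range b) := fun m =>
    Submodule.sum_mem _ fun j _ => by
      rw [Int.cast_smul_eq_zsmul]
      exact Submodule.smul_mem _ _ (Submodule.subset_span ⟨j, rfl⟩)
  refine (h1.comp_injective (i := fun m => ⟨latVec b m, hmem m⟩) fun m m' h =>
    latVec_injective b (congrArg Subtype.val h)).congr fun m => ?_
  simp

theorem summable_exp_neg_latVec (b : Module.Basis ι ℝ E) {c : ℝ} (hc : 0 < c) :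
    Summable fun m : ι → ℤ => Real.exp (-c * ‖latVec b m‖ ^ 2) := by
  obtain ⟨N, hN⟩ := summable_norm_latVec_pow_inv b
  obtain ⟨C, hC⟩ := exists_exp_neg_mul_sq_le N hc
  refine Summable.of_norm_bounded_eventually (hN.mul_left C) ?_
  -- The zero vector is excluded because there the inverse power is `0⁻¹ = 0`.
  refine (Set.finite_singleton (0 : ι → ℤ)).subset fun m hm => ?_
  by_contra hne
  refine hm ?_
  rw [Set.mem_ofPred_eq, Real.norm_of_nonneg (Real.exp_pos _).le]
  refine hC ‖latVec b m‖ (norm_pos_iff.2 fun h0 => hne ?_)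
  exact latVec_injective b (by rw [h0]; simp [latVec])

theorem summable_exp_neg_latVec_add (b : Module.Basis ι ℝ E) {c : ℝ} (hc : 0 < c) (u : E) :
    Summable fun m : ι → ℤ => Real.exp (-c * ‖latVec b m + u‖ ^ 2) :=
  Summable.of_nonneg_of_le (fun _ => (Real.exp_pos _).le)
    (fun _ => exp_neg_norm_add_sq_le hc.le _ u le_rfl)
    ((summable_exp_neg_latVec b (half_pos hc)).mul_left _)

theorem continuous_tsum_exp_neg_latVec_add (b : Module.Basis ι ℝ E) {c : ℝ} (hc : 0 < c) :
    Continuous fun u : E => ∑' m : ι → ℤ, ((Real.exp (-c * ‖latVec b m + u‖ ^ 2) : ℝ) : ℂ) := by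
  rw [continuous_iff_continuousAt]
  intro u
  have h : ContinuousOn (fun u : E => ∑' m : ι → ℤ,
      ((Real.exp (-c * ‖latVec b m + u‖ ^ 2) : ℝ) : ℂ)) (Metric.ball 0 (‖u‖ + 1)) := by
    refine continuousOn_tsum (fun m => by fun_prop)
      ((summable_exp_neg_latVec b (half_pos hc)).mul_left (Real.exp (c * (‖u‖ + 1) ^ 2)))
      fun m x hx => ?_
    rw [Complex.norm_real, Real.norm_of_nonneg (Real.exp_pos _).le]
    exact exp_neg_norm_add_sq_le hc.le _ x (mem_ball_zero_iff.1 hx).le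
  exact h.continuousAt (Metric.isOpen_ball.mem_nhds (by simp))

theorem inner_latVec_equivFun_symm [DecidableEq ι] (b : Module.Basis ι ℝ E) {d : ι → E}
    (hd : ∀ i j, inner ℝ (d i) (b j) = if i = j then (1 : ℝ) else 0) (m : ι → ℤ) (x : ι → ℝ) :
    inner ℝ (latVec d m) (b.equivFun.symm x) = ∑ i, (m i : ℝ) * x i := by
  rw [latVec, Module.Basis.equivFun_symm_apply, sum_inner]
  refine Finset.sum_congr rfl fun i _ => ?_
  rw [inner_smul_left, inner_sum]
  simp [inner_smul_right, hd]

-- Coordinates in `b` carry Lebesgue measure to a multiple of the volume of `E`. That multiple is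
-- `C`, so one constant serves all `s` and `u`; the rest is the Fourier transform of a Gaussian.
open MeasureTheory in
theorem integral_piChar_mul_gaussian [DecidableEq ι] (b : Module.Basis ι ℝ E) {d : ι → E}
    (hd : ∀ i j, inner ℝ (d i) (b j) = if i = j then (1 : ℝ) else 0) :
    ∃ C : ℝ, 0 < C ∧ ∀ s : ℝ, 0 < s → ∀ u : E,
      Integrable (fun x : ι → ℝ => ((Real.exp (-s * ‖b.equivFun.symm x + u‖ ^ 2) : ℝ) : ℂ)) ∧
      ∀ m : ι → ℤ,
        ∫ x : ι → ℝ, piChar (-m) x * ((Real.exp (-s * ‖b.equivFun.symm x + u‖ ^ 2) : ℝ) : ℂ) =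
          ((C * (Real.pi / s) ^ (Fintype.card ι / 2 : ℝ) *
          Real.exp (-(Real.pi ^ 2 / s) * ‖latVec d m‖ ^ 2) : ℝ) : ℂ) *
          Complex.exp (2 * Real.pi * Complex.I * ((inner ℝ (latVec d m) u : ℝ) : ℂ)) := by
  have : FiniteDimensional ℝ E := b.finiteDimensional_of_finite
  borelize E
  let T : (ι → ℝ) ≃L[ℝ] E := b.equivFun.symm.toContinuousLinearEquiv
  have hTe : MeasurableEmbedding T := T.toHomeomorph.measurableEmbedding
  have hHaar : (Measure.map T (volume : Measure (ι → ℝ))).IsAddHaarMeasure :=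
    T.isAddHaarMeasure_map _
  have hμ := Measure.isAddLeftInvariant_eq_smul (Measure.map T (volume : Measure (ι → ℝ)))
    (volume : Measure E)
  set c := Measure.addHaarScalarFactor (Measure.map T (volume : Measure (ι → ℝ)))
    (volume : Measure E) with hc
  have hc0 : 0 < c := Measure.addHaarScalarFactor_pos_of_isAddHaarMeasure _ _
  refine ⟨c, hc0, fun s hs u => ⟨?_, fun m => ?_⟩⟩
  · have h1 : Integrable (fun v : E => ((Real.exp (-s * ‖v + u‖ ^ 2) : ℝ) : ℂ))
        (Measure.map T volume) := by
      rw [hμ]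
      refine Integrable.smul_measure_nnreal ?_
      have h2 := GaussianFourier.integrable_cexp_neg_mul_sq_norm_add (V := E) (b := s)
        (by simpa using hs) 0 0
      refine (h2.comp_add_right u).congr (.of_forall fun v => ?_)
      push_cast
      simp
    exact (hTe.integrable_map_iff).1 h1
  · have h1 : ∀ x : ι → ℝ, piChar (-m) x = Complex.exp (-(2 * Real.pi * Complex.I) *
        ((inner ℝ (latVec d m) (T x) : ℝ) : ℂ)) := by
      intro x
      rw [show T x = b.equivFun.symm x from rfl, inner_latVec_equivFun_symm b hd, piChar]
      congr 1
      push_cast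
      simp
    have h2 : ∫ x : ι → ℝ, piChar (-m) x *
        ((Real.exp (-s * ‖b.equivFun.symm x + u‖ ^ 2) : ℝ) : ℂ) =
        ∫ v, Complex.exp (-(2 * Real.pi * Complex.I) * ((inner ℝ (latVec d m) v : ℝ) : ℂ)) *
          ((Real.exp (-s * ‖v + u‖ ^ 2) : ℝ) : ℂ) ∂(Measure.map T volume) := by
      rw [hTe.integral_map]
      simp only [h1]
      rfl
    rw [h2, hμ, integral_smul_nnreal_measure]
    have h3 := integral_add_right_eq_self (μ := (volume : Measure E))
      (fun v => Complex.exp (-(2 * Real.pi * Complex.I) *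
        ((inner ℝ (latVec d m) (v - u) : ℝ) : ℂ)) *
          ((Real.exp (-s * ‖v‖ ^ 2) : ℝ) : ℂ)) u
    simp only [add_sub_cancel_right] at h3
    rw [h3]
    have h4 := GaussianFourier.integral_cexp_neg_mul_sq_norm_add (V := E) (b := s)
        (by simpa using hs) (-(2 * Real.pi * Complex.I)) (latVec d m)
    have h5 : ∀ v : E, Complex.exp (-(2 * Real.pi * Complex.I) *
        ((inner ℝ (latVec d m) (v - u) : ℝ) : ℂ)) * ((Real.exp (-s * ‖v‖ ^ 2) : ℝ) : ℂ) =
        Complex.exp (2 * Real.pi * Complex.I * ((inner ℝ (latVec d m) u : ℝ) : ℂ)) *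
        Complex.exp (-s * ‖v‖ ^ 2 + -(2 * Real.pi * Complex.I) *
          ((inner ℝ (latVec d m) v : ℝ) : ℂ)) := by
      intro v
      push_cast
      rw [← Complex.exp_add, ← Complex.exp_add, inner_sub_right]
      congr 1
      push_cast
      ring
    simp only [h5]
    rw [integral_const_mul, h4, Module.finrank_eq_card_basis b]
    have h6 : ((Real.pi / s : ℝ) : ℂ) ^ ((Fintype.card ι / 2 : ℝ) : ℂ) =
        (((Real.pi / s) ^ (Fintype.card ι / 2 : ℝ) : ℝ) : ℂ) :=
      (Complex.ofReal_cpow (by positivity) _).symm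
    rw [NNReal.smul_def, Complex.real_smul]
    push_cast at h6 ⊢
    rw [h6]
    have h7 : (-(2 * Real.pi * Complex.I)) ^ 2 * (‖latVec d m‖ : ℂ) ^ 2 / (4 * s) =
        -(Real.pi ^ 2 / s) * (‖latVec d m‖ : ℂ) ^ 2 := by
      have : (s : ℂ) ≠ 0 := by exact_mod_cast hs.ne'
      have hI : (-(2 * Real.pi * Complex.I)) ^ 2 = -(4 * Real.pi ^ 2 : ℂ) := by
        linear_combination (4 * (Real.pi : ℂ) ^ 2) * Complex.I_sq
      rw [hI]
      field_simp
    rw [h7]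
    ring

/-- The theta series of a lattice coset, expanded over the dual lattice. -/
theorem exists_hasSum_theta [DecidableEq ι] (b d : Module.Basis ι ℝ E)
    (hd : ∀ i j, inner ℝ (d i) (b j) = if i = j then (1 : ℝ) else 0) :
    ∃ C : ℝ, 0 < C ∧ ∀ s : ℝ, 0 < s → ∀ u : E,
      HasSum (fun m : ι → ℤ => C * (Real.pi / s) ^ (Fintype.card ι / 2 : ℝ) *
          Real.exp (-(Real.pi ^ 2 / s) * ‖latVec d m‖ ^ 2) *
          Real.cos (2 * Real.pi * inner ℝ (latVec d m) u))
        (∑' m : ι → ℤ, Real.exp (-s * ‖latVec b m + u‖ ^ 2)) := by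
  have : FiniteDimensional ℝ E := b.finiteDimensional_of_finite
  obtain ⟨C, hC, h⟩ := integral_piChar_mul_gaussian b hd
  refine ⟨C, hC, fun s hs u => ?_⟩
  obtain ⟨hint, hcoef⟩ := h s hs u
  have hshift : ∀ (x : ι → ℝ) (m : ι → ℤ), b.equivFun.symm (x + fun i => (m i : ℝ)) + u =
      latVec b m + (b.equivFun.symm x + u) := by
    intro x m
    rw [map_add, latVec_eq_equivFun_symm]
    abel
  have hcont : Continuous fun x : ι → ℝ => ∑' m : ι → ℤ,
      ((Real.exp (-s * ‖b.equivFun.symm (x + fun i => (m i : ℝ)) + u‖ ^ 2) : ℝ) : ℂ) := by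
    simp only [hshift]
    refine (continuous_tsum_exp_neg_latVec_add b hs).comp ?_
    exact (LinearMap.continuous_of_finiteDimensional
      (b.equivFun.symm : (ι → ℝ) →ₗ[ℝ] E)).add continuous_const
  have hsum := (summable_exp_neg_latVec d (c := Real.pi ^ 2 / s) (by positivity)).mul_left
    (C * (Real.pi / s) ^ (Fintype.card ι / 2 : ℝ))
  have hnorm : ∀ y : ℝ, ‖Complex.exp (2 * Real.pi * Complex.I * (y : ℂ))‖ = 1 := by
    intro y
    rw [show 2 * Real.pi * Complex.I * (y : ℂ) = ((2 * Real.pi * y : ℝ) : ℂ) * Complex.I by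
      push_cast; ring]
    exact Complex.norm_exp_ofReal_mul_I _
  have hP := hasSum_poisson_pi hint hcont (by
    simp only [hcoef]
    refine Summable.of_norm_bounded hsum fun m => ?_
    rw [norm_mul, hnorm, mul_one, Complex.norm_real, Real.norm_of_nonneg (by positivity)]) 0
  simp only [hcoef, zero_add, ← latVec_eq_equivFun_symm] at hP
  have hre := Complex.hasSum_re hP
  rw [← Complex.ofReal_tsum, Complex.ofReal_re] at hre
  refine hre.congr_fun fun m => ?_
  have : piChar m (0 : ι → ℝ) = 1 := by simp [piChar]
  rw [this, mul_one, Complex.re_ofReal_mul,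
    show 2 * Real.pi * Complex.I * ((inner ℝ (latVec d m) u : ℝ) : ℂ) =
      ((2 * Real.pi * inner ℝ (latVec d m) u : ℝ) : ℂ) * Complex.I by push_cast; ring,
    Complex.exp_ofReal_mul_I_re]

end

/-! ### Banaszczyk's transference theorem. -/

theorem tsum_exp_antitone {ι : Type*} {v : ι → ℝ} {s t : ℝ} (hst : s ≤ t)
    (hs : Summable fun m => Real.exp (-s * v m ^ 2))
    (ht : Summable fun m => Real.exp (-t * v m ^ 2)) :
    ∑' m, Real.exp (-t * v m ^ 2) ≤ ∑' m, Real.exp (-s * v m ^ 2) :=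
  ht.tsum_le_tsum (fun m => Real.exp_le_exp.2 (by nlinarith [sq_nonneg (v m)])) hs

/-- The tail estimate: outside radius `R`, a fraction `1 - 1 / a` of the exponent is traded for a
constant factor, leaving a wider Gaussian. -/
theorem exp_neg_mul_sq_le_of_le {s a r R : ℝ} (hs : 0 ≤ s) (ha : 1 ≤ a) (hR : 0 ≤ R)
    (hr : R ≤ r) :
    Real.exp (-s * r ^ 2) ≤
      Real.exp (-((1 - 1 / a) * (s * R ^ 2))) * Real.exp (-(s / a) * r ^ 2) := by
  rw [← Real.exp_add]
  refine Real.exp_le_exp.2 ?_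
  have h1 : R ^ 2 ≤ r ^ 2 := pow_le_pow_left₀ hR hr 2
  have h2 : 0 ≤ 1 - 1 / a := by
    rw [sub_nonneg, div_le_one (by linarith)]
    exact ha
  have h3 : s * r ^ 2 = (1 - 1 / a) * (s * r ^ 2) + s / a * r ^ 2 := by
    field_simp
    ring
  have h4 := mul_le_mul_of_nonneg_left (mul_le_mul_of_nonneg_left h1 hs) h2
  linarith

/-- The left side equals `(a * exp (1 - a)) ^ (n / 2)`. The base is at most `1`, so for `n ≥ 2` the
power is at most the base. -/
theorem exp_mul_rpow_le {a q : ℝ} {n : ℕ} (hn : 2 ≤ n) (ha : 1 ≤ a)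
    (hq : a * Real.exp (1 - a) ≤ q) :
    Real.exp (-((1 - 1 / a) * (n * a / 2))) * a ^ (n / 2 : ℝ) ≤ q := by
  have ha0 : 0 < a := by linarith
  have h0 : 0 < a * Real.exp (1 - a) := by positivity
  have h1 : a * Real.exp (1 - a) ≤ 1 := by
    have h2 := Real.add_one_le_exp (a - 1)
    rw [← neg_sub, Real.exp_neg, ← div_eq_mul_inv, div_le_one (Real.exp_pos _)]
    linarith
  have h3 : Real.exp (-((1 - 1 / a) * (n * a / 2))) * a ^ (n / 2 : ℝ) =
      (a * Real.exp (1 - a)) ^ (n / 2 : ℝ) := by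
    rw [Real.mul_rpow ha0.le (Real.exp_pos _).le, ← Real.exp_mul, mul_comm]
    congr 2
    field_simp
    ring
  rw [h3]
  have hn' : (1 : ℝ) ≤ n / 2 := by
    have : (2 : ℝ) ≤ n := by exact_mod_cast hn
    linarith
  have h4 := Real.rpow_le_rpow_of_exponent_ge h0 h1 hn'
  rw [Real.rpow_one] at h4
  exact h4.trans hq

theorem five_mul_exp_le : (5 : ℝ) * Real.exp (1 - 5) ≤ 0.095 := by
  have h1 : (2.7 : ℝ) < Real.exp 1 := lt_trans (by norm_num) Real.exp_one_gt_d9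
  have h2 : (2.7 : ℝ) ^ 4 ≤ Real.exp 4 := by
    have := pow_le_pow_left₀ (by norm_num) h1.le 4
    rwa [← Real.exp_nat_mul, show ((4 : ℕ) : ℝ) * 1 = 4 by norm_num] at this
  rw [show (1 - 5 : ℝ) = -4 by norm_num, Real.exp_neg, ← div_eq_mul_inv,
    div_le_iff₀ (Real.exp_pos _)]
  norm_num at h2
  linarith

theorem one_le_pi_sq_div_five : (1 : ℝ) ≤ Real.pi ^ 2 / 5 := by
  nlinarith [Real.pi_gt_three]

theorem pi_sq_div_five_mul_exp_le :
    Real.pi ^ 2 / 5 * Real.exp (1 - Real.pi ^ 2 / 5) ≤ 0.8 := by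
  have hx : (0.97 : ℝ) ≤ Real.pi ^ 2 / 5 - 1 := by
    nlinarith [Real.pi_gt_d2]
  set x := Real.pi ^ 2 / 5 - 1 with hxd
  rw [show Real.pi ^ 2 / 5 = 1 + x by ring, show 1 - (1 + x) = -x by ring, Real.exp_neg,
    ← div_eq_mul_inv, div_le_iff₀ (Real.exp_pos _)]
  have h := Real.sum_le_exp_of_nonneg (x := x) (by linarith) 4
  norm_num [Finset.sum_range_succ, Nat.factorial] at h
  have h2 : 0.97 ^ 2 ≤ x ^ 2 := pow_le_pow_left₀ (by norm_num) hx 2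
  have h3 : 0.97 ^ 3 ≤ x ^ 3 := pow_le_pow_left₀ (by norm_num) hx 3
  have h4 : 0.97 * x ≤ x ^ 2 := by nlinarith
  norm_num at h2 h3
  nlinarith

section

variable {ι E : Type*} [Fintype ι] [NormedAddCommGroup E] [InnerProductSpace ℝ E]

theorem exists_dual_basis [DecidableEq ι] (b : Module.Basis ι ℝ E) :
    ∃ d : Module.Basis ι ℝ E, ∀ i j, inner ℝ (d i) (b j) = if i = j then (1 : ℝ) else 0 := by
  have hE : FiniteDimensional ℝ E := b.finiteDimensional_of_finite
  have hC : CompleteSpace E := FiniteDimensional.complete ℝ E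
  refine ⟨b.dualBasis.map (LinearMap.toContinuousLinearMap.trans
    (InnerProductSpace.toDual ℝ E).symm.toLinearEquiv), fun i j => ?_⟩
  simp [InnerProductSpace.toDual_symm_apply, Finsupp.single_apply, eq_comm]

theorem inner_latVec_basis [DecidableEq ι] {b d : ι → E}
    (hd : ∀ i j, inner ℝ (d i) (b j) = if i = j then (1 : ℝ) else 0) (m : ι → ℤ) (j : ι) :
    inner ℝ (latVec d m) (b j) = m j := by
  simp [latVec, sum_inner, inner_smul_left, hd]

/-- **Banaszczyk's transference theorem**: the covering radius of a lattice is less than half the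
dimension divided by the first minimum of the dual lattice, in dimension at least two. -/
theorem exists_norm_latVec_add_lt (b : Module.Basis ι ℝ E) (hn : 2 ≤ Fintype.card ι) {r : ℝ}
    (hr : 0 < r)
    (hdual : ∀ y : E, y ≠ 0 → (∀ j, ∃ z : ℤ, inner ℝ y (b j) = z) → r ≤ ‖y‖) (u : E) :
    ∃ m : ι → ℤ, ‖latVec b m + u‖ < Fintype.card ι / (2 * r) := by
  classical
  by_contra! hfar
  obtain ⟨d, hd⟩ := exists_dual_basis b
  obtain ⟨C, hC, hθ⟩ := exists_hasSum_theta b d hd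
  set n := Fintype.card ι with hn_def
  have hn0 : (0 : ℝ) < n := by
    have : 0 < n := by omega
    exact_mod_cast this
  set f : ℝ → E → ℝ := fun s u => ∑' m : ι → ℤ, Real.exp (-s * ‖latVec b m + u‖ ^ 2) with hf
  set g : ℝ → ℝ := fun s => ∑' m : ι → ℤ, Real.exp (-s * ‖latVec d m‖ ^ 2) with hg
  have hfs : ∀ {s : ℝ}, 0 < s → ∀ u : E,
      Summable fun m : ι → ℤ => Real.exp (-s * ‖latVec b m + u‖ ^ 2) :=
    fun hs u => summable_exp_neg_latVec_add b hs u
  have hgs : ∀ {s : ℝ}, 0 < s → Summable fun m : ι → ℤ => Real.exp (-s * ‖latVec d m‖ ^ 2) :=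
    fun hs => summable_exp_neg_latVec d hs
  have hfanti : ∀ {s t : ℝ}, 0 < s → s ≤ t → f t 0 ≤ f s 0 := fun hs hst =>
    tsum_exp_antitone hst (hfs hs 0) (hfs (hs.trans_le hst) 0)
  have hganti : ∀ {s t : ℝ}, 0 < s → s ≤ t → g t ≤ g s := fun hs hst =>
    tsum_exp_antitone hst (hgs hs) (hgs (hs.trans_le hst))
  have hfg : ∀ {s : ℝ}, 0 < s → f s 0 = C * (Real.pi / s) ^ (n / 2 : ℝ) * g (Real.pi ^ 2 / s) := by
    intro s hs
    have h1 := hθ s hs 0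
    simp only [inner_zero_right, mul_zero, Real.cos_zero, mul_one] at h1
    rw [hg, ← tsum_mul_left]
    exact h1.tsum_eq.symm
  have hπ := Real.pi_pos
  have hf_le : ∀ {s : ℝ}, 0 < s → ∀ u, f s u ≤ f s 0 := by
    intro s hs u
    have h1 := hθ s hs 0
    simp only [inner_zero_right, mul_zero, Real.cos_zero, mul_one] at h1
    refine hasSum_le (fun m => ?_) (hθ s hs u) h1
    exact mul_le_of_le_one_right (by positivity) (Real.cos_le_one _)
  -- Widening the Gaussian costs at most `a ^ (n / 2)`: the prefactor in Poisson summation accounts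
  -- for that power, and the dual sum only decreases.
  have hf_scale : ∀ {s a : ℝ}, 0 < s → 1 ≤ a → f (s / a) 0 ≤ a ^ (n / 2 : ℝ) * f s 0 := by
    intro s a hs ha
    have ha0 : 0 < a := by linarith
    rw [hfg hs, hfg (div_pos hs ha0), show Real.pi / (s / a) = a * (Real.pi / s) by field_simp,
      Real.mul_rpow ha0.le (by positivity)]
    have h1 : g (Real.pi ^ 2 / (s / a)) ≤ g (Real.pi ^ 2 / s) := by
      refine hganti (by positivity) ?_
      exact div_le_div_of_nonneg_left (by positivity) (by positivity) (div_le_self hs.le ha)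
    calc C * (a ^ (n / 2 : ℝ) * (Real.pi / s) ^ (n / 2 : ℝ)) * g (Real.pi ^ 2 / (s / a))
        ≤ C * (a ^ (n / 2 : ℝ) * (Real.pi / s) ^ (n / 2 : ℝ)) * g (Real.pi ^ 2 / s) := by gcongr
      _ = _ := by ring
  have hg_scale : ∀ {s a : ℝ}, 0 < s → 1 ≤ a → g (s / a) ≤ a ^ (n / 2 : ℝ) * g s := by
    intro s a hs ha
    have ha0 : 0 < a := by linarith
    set t := Real.pi ^ 2 / s with ht
    have ht0 : 0 < t := by positivity
    have h1 := hfanti ht0 (le_mul_of_one_le_right ht0.le ha)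
    rw [hfg ht0, hfg (mul_pos ht0 ha0), show Real.pi ^ 2 / (t * a) = s / a by rw [ht]; field_simp,
      show Real.pi ^ 2 / t = s by rw [ht]; field_simp,
      show Real.pi / t = a * (Real.pi / (t * a)) by field_simp,
      Real.mul_rpow ha0.le (by positivity)] at h1
    have h2 : 0 < C * (Real.pi / (t * a)) ^ (n / 2 : ℝ) := by positivity
    refine le_of_mul_le_mul_left (h1.trans_eq ?_) h2
    ring
  -- the dual tail
  set s' : ℝ := n * 5 / (2 * r ^ 2) with hs'
  have hs'0 : 0 < s' := by positivity
  -- Poisson summation pairs `s` with `s'`. Since `s' r² = 5n / 2`, the radius `R = n / (2r)`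
  -- satisfies `s R² = c n / 2` with `c = π² / 5`, so `exp_mul_rpow_le` applies on both sides, with
  -- `a = 5` and `a = c`.
  set s : ℝ := Real.pi ^ 2 / s' with hs
  have hs0 : 0 < s := by positivity
  set c := Real.pi ^ 2 / 5 with hc
  have hc1 : 1 ≤ c := one_le_pi_sq_div_five
  have hδ := hasSum_ite_eq (0 : ι → ℤ) (1 : ℝ)
  have hg1 : g s' ≤ 1 + 0.095 * g s' := by
    have h1 : g s' ≤ 1 + Real.exp (-((1 - 1 / 5) * (s' * r ^ 2))) * g (s' / 5) := by
      refine hasSum_le (fun m => ?_) (hgs hs'0).hasSum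
        (hδ.add ((hgs (by positivity : 0 < s' / 5)).hasSum.mul_left _))
      by_cases hm : m = 0
      · subst hm
        simp only [latVec, Pi.zero_apply, Int.cast_zero, zero_smul, Finset.sum_const_zero,
          norm_zero, if_true]
        have := Real.exp_pos (-((1 - 1 / 5) * (s' * r ^ 2)))
        simp
        positivity
      · rw [if_neg hm, zero_add]
        refine exp_neg_mul_sq_le_of_le hs'0.le (by norm_num) hr.le (hdual _ (fun h0 => hm ?_) ?_)
        · exact latVec_injective d (by rw [h0]; simp [latVec])
        · exact fun j => ⟨m j, inner_latVec_basis hd m j⟩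
    have h2 := exp_mul_rpow_le hn (by norm_num : (1 : ℝ) ≤ 5) five_mul_exp_le
    have h3 : s' * r ^ 2 = n * 5 / 2 := by rw [hs']; field_simp
    rw [h3] at h1
    have hg0 : 0 ≤ g s' := tsum_nonneg fun _ => (Real.exp_pos _).le
    calc g s' ≤ _ := h1
      _ ≤ 1 + Real.exp (-((1 - 1 / 5) * (n * 5 / 2))) * (5 ^ (n / 2 : ℝ) * g s') := by
          gcongr
          exact hg_scale hs'0 (by norm_num)
      _ = 1 + Real.exp (-((1 - 1 / 5) * (n * 5 / 2))) * 5 ^ (n / 2 : ℝ) * g s' := by ring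
      _ ≤ _ := by gcongr
  -- far points see little mass
  have hup : f s u ≤ 0.8 * f s 0 := by
    set R : ℝ := n / (2 * r) with hR
    have hR0 : 0 ≤ R := by positivity
    have h1 : f s u ≤ Real.exp (-((1 - 1 / c) * (s * R ^ 2))) * f (s / c) u := by
      refine hasSum_le (fun m => ?_) (hfs hs0 u).hasSum
        ((hfs (by positivity : 0 < s / c) u).hasSum.mul_left _)
      exact exp_neg_mul_sq_le_of_le hs0.le hc1 hR0 (hfar m)
    have h2 := exp_mul_rpow_le hn hc1 pi_sq_div_five_mul_exp_le
    have h3 : s * R ^ 2 = n * c / 2 := by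
      rw [hs, hs', hR, hc]
      field_simp
    rw [h3] at h1
    have hf0 : 0 ≤ f s 0 := tsum_nonneg fun _ => (Real.exp_pos _).le
    calc f s u ≤ _ := h1
      _ ≤ Real.exp (-((1 - 1 / c) * (n * c / 2))) * (c ^ (n / 2 : ℝ) * f s 0) := by
          gcongr
          exact (hf_le (by positivity) u).trans (hf_scale hs0 hc1)
      _ = Real.exp (-((1 - 1 / c) * (n * c / 2))) * c ^ (n / 2 : ℝ) * f s 0 := by ring
      _ ≤ _ := by gcongr
  have hss : Real.pi ^ 2 / s = s' := by rw [hs]; field_simp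
  set K := C * (Real.pi / s) ^ (n / 2 : ℝ) with hK
  have hK0 : 0 < K := by positivity
  -- The zero dual vector contributes `1` and each other cosine is at least `-1`, so the series is
  -- at least `1 - (g s' - 1)`.
  have hlow : K * (2 - g s') ≤ f s u := by
    have h1 := hθ s hs0 u
    rw [hss] at h1
    refine hasSum_le (fun m => ?_) ((((hδ.mul_left 2).sub (hgs hs'0).hasSum).mul_left K)) h1 |>.trans_eq' ?_
    · rw [mul_assoc K]
      refine mul_le_mul_of_nonneg_left ?_ hK0.le
      by_cases hm : m = 0
      · subst hm
        simp [latVec]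
        norm_num
      · rw [if_neg hm]
        have h2 := Real.neg_one_le_cos (2 * Real.pi * inner ℝ (latVec d m) u)
        have h3 := Real.exp_pos (-s' * ‖latVec d m‖ ^ 2)
        nlinarith
    · rw [mul_one]
  rw [hfg hs0, hss] at hup
  have hg0 : 0 ≤ g s' := tsum_nonneg fun _ => (Real.exp_pos _).le
  have h5 : K * (2 - g s') ≤ K * (0.8 * g s') := by
    refine hlow.trans (hup.trans_eq ?_)
    ring
  -- Now `g s' ≥ 2 / 1.8 > 1.111`, whereas the dual tail gives `g s' ≤ 1 / 0.905 < 1.105`.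
  have h6 := le_of_mul_le_mul_left h5 hK0
  norm_num at h6 hg1
  linarith

end

/-! ### Elimination of the squared Gram–Schmidt norms. -/

/-- One elimination step. Adding `T - T'` times the covering inequality to `(1 - T) U ≤ T V`
replaces `T` by `T'`; the value `T' = (x T - ε) / (x - 1 / 4)` is the one for which the `β` terms
match when the current index moves from `U` to `V`. -/
theorem ellipsoid_step {U V ε β T x : ℝ} (hx : 1 / 4 < x) (hT0 : 0 ≤ T) (hT1 : T ≤ 1)
    (hUV : (1 - T) * U ≤ T * V) (hcov : U + V ≤ x * β) (hβ : 0 < β) (hε : 1 / 4 ≤ ε)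
    (hU : ε * β ≤ U) :
    0 ≤ (x * T - ε) / (x - 1 / 4) ∧ (x * T - ε) / (x - 1 / 4) ≤ 1 ∧
      (1 - (x * T - ε) / (x - 1 / 4)) * (U - ε * β) ≤
        (x * T - ε) / (x - 1 / 4) * (V + (ε - 1 / 4) * β) := by
  have hx' : 0 < x - 1 / 4 := by linarith
  have h1 : ε ≤ x * T := by
    have h2 := mul_le_mul_of_nonneg_left hcov hT0
    have : ε * β ≤ x * T * β := by nlinarith
    exact le_of_mul_le_mul_right this hβ
  set T' := (x * T - ε) / (x - 1 / 4) with hT'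
  have hT'x : T' * (x - 1 / 4) = x * T - ε := div_mul_cancel₀ _ hx'.ne'
  have hT'0 : 0 ≤ T' := div_nonneg (by linarith) hx'.le
  have hT'1 : T' ≤ 1 := by
    rw [hT', div_le_one hx']
    nlinarith
  refine ⟨hT'0, hT'1, ?_⟩
  -- Nonnegativity of the multiplier `T - T'` follows from `ε ≥ 1 / 4` and `T' ≤ 1`.
  have hy : x * (T - T') = ε - T' / 4 := by linarith
  have hy0 : 0 ≤ T - T' := by
    have : 0 ≤ x * (T - T') := by linarith
    exact nonneg_of_mul_nonneg_right this (by linarith)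
  have h3 := mul_le_mul_of_nonneg_left hcov hy0
  have h4 : (T - T') * (x * β) = (ε - T' / 4) * β := by rw [← hy]; ring
  nlinarith

namespace DualHKZ

theorem idx_pos {n : ℕ} (j : Fin n) : 0 < idx j := by
  unfold idx
  positivity

theorem one_lt_idx {n : ℕ} {i j : Fin n} (h : i < j) : 1 < idx j := by
  have : 0 < (j : ℕ) := lt_of_le_of_lt (Nat.zero_le _) h
  have : (0 : ℝ) < (j : ℕ) := by exact_mod_cast this
  unfold idx
  linarith

theorem one_div_four_lt_idx {n : ℕ} {i j : Fin n} (h : i < j) : 1 / 4 < idx j ^ 2 / 4 := by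
  nlinarith [one_lt_idx h]

theorem prod_Ioc_pos {n : ℕ} (i j : Fin n) :
    0 < ∏ l ∈ Finset.Ioc i j, (idx l ^ 2 / 4 - 1 / 4) :=
  Finset.prod_pos fun _ hl => by linarith [one_div_four_lt_idx (Finset.mem_Ioc.1 hl).1]

theorem weight_pos {n : ℕ} (i j : Fin n) : 0 < weight i j :=
  div_pos (Finset.prod_pos fun l _ => by have := idx_pos l; positivity) (prod_Ioc_pos i j)

theorem bound_pos {n : ℕ} (i k : Fin n) : 0 < bound i k :=
  div_pos (Finset.prod_pos fun l _ => by have := idx_pos l; positivity) (prod_Ioc_pos i k)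

theorem Ioc_eq_insert_succ {n : ℕ} {p q k : Fin n} (hq : (q : ℕ) = p + 1) (hk : q ≤ k) :
    Finset.Ioc p k = insert q (Finset.Ioc q k) := by
  ext l
  simp only [Finset.mem_Ioc, Finset.mem_insert, Fin.lt_def, Fin.le_def, Fin.ext_iff] at *
  omega

theorem Icc_eq_insert_succ {n : ℕ} {p q k : Fin n} (hq : (q : ℕ) = p + 1) (hk : q ≤ k) :
    Finset.Icc p k = insert p (Finset.Icc q k) := by
  ext l
  simp only [Finset.mem_Icc, Finset.mem_insert, Fin.le_def, Fin.ext_iff] at *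
  omega

theorem Ico_eq_insert_succ {n : ℕ} {p q k : Fin n} (hq : (q : ℕ) = p + 1) (hk : q ≤ k) :
    Finset.Ico p k = insert p (Finset.Ico q k) := by
  ext l
  simp only [Finset.mem_Ico, Finset.mem_insert, Fin.lt_def, Fin.le_def, Fin.ext_iff] at *
  omega

theorem Iic_eq_insert_succ {n : ℕ} {p q : Fin n} (hq : (q : ℕ) = p + 1) :
    Finset.Iic q = insert q (Finset.Iic p) := by
  ext l
  simp only [Finset.mem_Iic, Finset.mem_insert, Fin.le_def, Fin.ext_iff] at *
  omega

theorem bound_succ {n : ℕ} {p q k : Fin n} (hq : (q : ℕ) = p + 1) (hk : q ≤ k) :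
    bound p k = idx p ^ 2 / 4 / (idx q ^ 2 / 4 - 1 / 4) * bound q k := by
  have h1 : p ∉ Finset.Icc q k := by
    simp only [Finset.mem_Icc, Fin.le_def]
    omega
  rw [bound, Icc_eq_insert_succ hq hk, Ioc_eq_insert_succ hq hk, Finset.prod_insert h1,
    Finset.prod_insert (by simp), bound, mul_div_mul_comm]

theorem weight_succ {n : ℕ} {p q k : Fin n} (hq : (q : ℕ) = p + 1) (hk : q ≤ k) :
    weight p k = idx p ^ 2 / 4 / (idx q ^ 2 / 4 - 1 / 4) * weight q k := by
  have h1 : p ∉ Finset.Ico q k := by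
    simp only [Finset.mem_Ico, Fin.le_def]
    omega
  rw [weight, Ico_eq_insert_succ hq hk, Ioc_eq_insert_succ hq hk, Finset.prod_insert h1,
    Finset.prod_insert (by simp), weight, mul_div_mul_comm]

theorem weight_self {n : ℕ} (k : Fin n) : weight k k = 1 := by
  simp [weight]

/-- The slack left for `ε p` by the ellipsoid inequality. -/
noncomputable def slack {n : ℕ} (ε : Fin n → ℝ) (p k : Fin n) : ℝ :=
  bound p k - ∑ j ∈ Finset.Ioc p k, ε j * weight p j

theorem slack_self {n : ℕ} (ε : Fin n → ℝ) (k : Fin n) : slack ε k k = idx k ^ 2 / 4 := by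
  simp [slack, bound]

/-- This recursion is the update of `T` in `ellipsoid_step`, with `slack = x * T`. -/
theorem slack_succ {n : ℕ} (ε : Fin n → ℝ) {p q k : Fin n} (hq : (q : ℕ) = p + 1) (hk : q ≤ k) :
    slack ε p k = idx p ^ 2 / 4 * ((slack ε q k - ε q) / (idx q ^ 2 / 4 - 1 / 4)) := by
  rw [slack, bound_succ hq hk, Ioc_eq_insert_succ hq hk, Finset.sum_insert (by simp),
    weight_succ hq le_rfl, weight_self]
  have h1 : ∑ j ∈ Finset.Ioc q k, ε j * weight p j =
      idx p ^ 2 / 4 / (idx q ^ 2 / 4 - 1 / 4) * ∑ j ∈ Finset.Ioc q k, ε j * weight q j := by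
    rw [Finset.mul_sum]
    refine Finset.sum_congr rfl fun j hj => ?_
    rw [weight_succ hq (Finset.mem_Ioc.1 hj).1.le]
    ring
  rw [h1, slack]
  ring

theorem le_slack_of_covering {n : ℕ} {ε β : Fin n → ℝ} (hε : ∀ j, 0 ≤ ε j) (hβ : ∀ j, 0 < β j)
    {i k : Fin n} (hik : i ≤ k) (hlarge : ∀ j ∈ Finset.Ioc i k, 1 / 4 ≤ ε j)
    (hcov : ∀ p, i ≤ p → p ≤ k → ∑ j ∈ Finset.Iic k, ε j * β j ≤
      idx p ^ 2 / 4 * β p + 1 / 4 * ∑ j ∈ Finset.Ioc p k, β j) :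
    ε i ≤ slack ε i k := by
  have hcov' : ∀ p, i ≤ p → p ≤ k → ∑ j ∈ Finset.Iic p, ε j * β j +
      ∑ j ∈ Finset.Ioc p k, (ε j - 1 / 4) * β j ≤ idx p ^ 2 / 4 * β p := by
    intro p hip hpk
    have h1 := hcov p hip hpk
    have h2 : Finset.Iic k = (Finset.Iic p).disjUnion (Finset.Ioc p k)
        (Finset.disjoint_left.2 fun j hj hj' =>
          absurd (Finset.mem_Ioc.1 hj').1 (Finset.mem_Iic.1 hj).not_gt) := by
      ext j
      simp only [Finset.mem_Iic, Finset.mem_disjUnion, Finset.mem_Ioc]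
      constructor
      · intro h
        rcases le_or_gt j p with h' | h'
        · exact Or.inl h'
        · exact Or.inr ⟨h', h⟩
      · rintro (h | h)
        · exact h.trans hpk
        · exact h.2
    rw [h2, Finset.sum_disjUnion] at h1
    have h3 : ∑ j ∈ Finset.Ioc p k, (ε j - 1 / 4) * β j =
        ∑ j ∈ Finset.Ioc p k, ε j * β j - 1 / 4 * ∑ j ∈ Finset.Ioc p k, β j := by
      rw [Finset.mul_sum, ← Finset.sum_sub_distrib]
      exact Finset.sum_congr rfl fun j _ => by ring
    linarith
  have hU : ∀ p, ε p * β p ≤ ∑ j ∈ Finset.Iic p, ε j * β j := fun p =>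
    Finset.single_le_sum (f := fun j => ε j * β j) (fun j _ => mul_nonneg (hε j) (hβ j).le)
      (Finset.mem_Iic.2 le_rfl)
  have hx : ∀ p : Fin n, 0 < idx p ^ 2 / 4 := fun p => by have := idx_pos p; positivity
  -- Downward induction on `p`, starting at `p = k` with `T = 1` and an empty sum on the right.
  have key : ∀ m : ℕ, ∀ p : Fin n, i ≤ p → (p : ℕ) + m = k →
      ∃ T, slack ε p k = idx p ^ 2 / 4 * T ∧ 0 ≤ T ∧ T ≤ 1 ∧
        (1 - T) * ∑ j ∈ Finset.Iic p, ε j * β j ≤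
          T * ∑ j ∈ Finset.Ioc p k, (ε j - 1 / 4) * β j := by
    intro m
    induction m with
    | zero =>
      intro p _ hpk
      obtain rfl : p = k := Fin.ext (by simpa using hpk)
      exact ⟨1, by simp [slack_self], by norm_num, le_rfl, by simp⟩
    | succ m ih =>
      intro p hip hpk
      obtain ⟨q, hq⟩ : ∃ q : Fin n, (q : ℕ) = p + 1 := ⟨⟨p + 1, by omega⟩, rfl⟩
      have hqk : q ≤ k := by rw [Fin.le_def]; omega
      have hiq : i < q := by
        rw [Fin.lt_def]
        rw [Fin.le_def] at hip
        omega
      obtain ⟨T, hT, hT0, hT1, hTUV⟩ := ih q hiq.le (by omega)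
      obtain ⟨h1, h2, h3⟩ := ellipsoid_step (one_div_four_lt_idx hiq) hT0 hT1 hTUV
        (hcov' q hiq.le hqk) (hβ q) (hlarge q (Finset.mem_Ioc.2 ⟨hiq, hqk⟩)) (hU q)
      refine ⟨_, ?_, h1, h2, ?_⟩
      · rw [slack_succ ε hq hqk, hT]
      · rw [Iic_eq_insert_succ hq, Finset.sum_insert, add_sub_cancel_left] at h3
        · rwa [Ioc_eq_insert_succ hq hqk, Finset.sum_insert (by simp), add_comm ((ε q - 1 / 4) * β q)]
        · simp only [Finset.mem_Iic, Fin.le_def]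
          omega
  obtain ⟨T, hT, hT0, hT1, hTUV⟩ := key (k - i) i le_rfl (by rw [Fin.le_def] at hik; omega)
  rw [hT]
  have h1 := mul_le_mul_of_nonneg_left (hcov' i le_rfl hik) hT0
  have h2 := hU i
  have h3 : ε i * β i ≤ idx i ^ 2 / 4 * T * β i := by nlinarith
  exact le_of_mul_le_mul_right h3 (hβ i)

end DualHKZ

/-! ### Geometry of dual HKZ-bases and closest vectors. -/

namespace DualHKZ

theorem inner_gs_eq_zero_of_mem {n m : ℕ} (b : Fin m → EuclideanSpace ℝ (Fin n)) {k : Fin m}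
    {x : EuclideanSpace ℝ (Fin n)} (hx : x ∈ Submodule.span ℝ (b '' Set.Iio k)) :
    inner ℝ (gs b k) x = 0 := by
  induction hx using Submodule.span_induction with
  | mem x h =>
    obtain ⟨j, hj, rfl⟩ := h
    exact InnerProductSpace.gramSchmidt_inv_triangular ℝ b hj
  | zero => exact inner_zero_right _
  | add x y _ _ hx hy => rw [inner_add_right, hx, hy, add_zero]
  | smul a x _ hx => rw [inner_smul_right, hx, mul_zero]

theorem sub_gs_mem_span {n m : ℕ} (b : Fin m → EuclideanSpace ℝ (Fin n)) (k : Fin m) :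
    b k - gs b k ∈ Submodule.span ℝ (b '' Set.Iio k) := by
  have h := InnerProductSpace.gramSchmidt_def'' ℝ b k
  have h2 : b k - gs b k = ∑ i ∈ Finset.Iio k,
      (inner ℝ (gs b i) (b k) / (‖gs b i‖ : ℝ) ^ 2) • gs b i := by
    rw [sub_eq_iff_eq_add']
    exact h
  rw [h2, ← InnerProductSpace.span_gramSchmidt_Iio ℝ b k]
  exact Submodule.sum_mem _ fun i hi => Submodule.smul_mem _ _
    (Submodule.subset_span ⟨i, Finset.mem_Iio.1 hi, rfl⟩)

theorem gs_mem_span_Iic {n m : ℕ} (b : Fin m → EuclideanSpace ℝ (Fin n)) {j k : Fin m}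
    (hjk : j ≤ k) : gs b j ∈ Submodule.span ℝ (b '' Set.Iic k) :=
  InnerProductSpace.gramSchmidt_mem_span ℝ b hjk

theorem gs_ne_zero {n m : ℕ} {b : Fin m → EuclideanSpace ℝ (Fin n)}
    (hb : LinearIndependent ℝ b) (k : Fin m) : gs b k ≠ 0 :=
  InnerProductSpace.gramSchmidt_ne_zero k hb

theorem image_Iic_eq_insert {n m : ℕ} (b : Fin m → EuclideanSpace ℝ (Fin n)) (k : Fin m) :
    b '' Set.Iic k = insert (b k) (b '' Set.Iio k) := by
  rw [← Set.Iio_insert, Set.image_insert_eq]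

theorem inner_eq_zero_of_mem_span {n : ℕ} {S T : Set (EuclideanSpace ℝ (Fin n))}
    (h : ∀ x ∈ S, ∀ y ∈ T, inner ℝ x y = (0 : ℝ)) {x y : EuclideanSpace ℝ (Fin n)}
    (hx : x ∈ Submodule.span ℝ S) (hy : y ∈ Submodule.span ℝ T) : inner ℝ x y = (0 : ℝ) :=
  Submodule.isOrtho_iff_inner_eq.1 (Submodule.isOrtho_span.2 fun x hx y hy => h x hx y hy) x hx y hy

theorem inner_eq_zero_of_isReverseDual {n m : ℕ} {b d : Fin m → EuclideanSpace ℝ (Fin n)}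
    (hd : IsReverseDual b d) {p : Fin m} {x y : EuclideanSpace ℝ (Fin n)}
    (hx : x ∈ Submodule.span ℝ (d '' Set.Iio p.rev))
    (hy : y ∈ Submodule.span ℝ (b '' Set.Iic p)) : inner ℝ x y = (0 : ℝ) := by
  refine inner_eq_zero_of_mem_span ?_ hx hy
  rintro _ ⟨l, hl, rfl⟩ _ ⟨j, hj, rfl⟩
  rw [hd.2, if_neg]
  rintro rfl
  rw [Set.mem_Iio, Fin.rev_lt_rev] at hl
  exact absurd hl (not_lt.2 hj)

theorem eq_sum_inner_smul_reverseDual {n : ℕ} {b d : Fin n → EuclideanSpace ℝ (Fin n)}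
    (hb : LinearIndependent ℝ b) (hd : IsReverseDual b d) (y : EuclideanSpace ℝ (Fin n)) :
    y = ∑ l, (inner ℝ y (b l.rev) : ℝ) • d l := by
  have hspan : Submodule.span ℝ (Set.range b) = ⊤ :=
    hb.span_eq_top_of_card_eq_finrank' (by simp)
  refine InnerProductSpace.ext_inner_right_basis (Module.Basis.mk hb hspan.ge) fun j => ?_
  rw [Module.Basis.mk_apply, sum_inner, Finset.sum_eq_single j.rev]
  · rw [inner_smul_left, hd.2, if_pos rfl, Fin.rev_rev]
    simp
  · intro l _ hl
    rw [inner_smul_left, hd.2, if_neg hl, mul_zero]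
  · exact fun h => absurd (Finset.mem_univ _) h

/-- Such a `y` lies in the dual of the lattice of `b_1, …, b_p`, hence in a projected lattice of
`d`, whose shortest nonzero vectors have norm `‖gs d p.rev‖`. This vector has inner product `1` with
`gs b p`, and Cauchy–Schwarz concludes. -/
theorem one_div_norm_gs_le {n : ℕ} {b d : Fin n → EuclideanSpace ℝ (Fin n)}
    (hb : LinearIndependent ℝ b) (hd : IsReverseDual b d) (hH : IsHKZ d) (p : Fin n)
    {y : EuclideanSpace ℝ (Fin n)} (hy : y ∈ Submodule.span ℝ (b '' Set.Iic p)) (hy0 : y ≠ 0)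
    (hint : ∀ j ≤ p, ∃ z : ℤ, inner ℝ y (b j) = (z : ℝ)) : 1 / ‖gs b p‖ ≤ ‖y‖ := by
  have hgs : gs b p ∈ Submodule.span ℝ (b '' Set.Iic p) := gs_mem_span_Iic b le_rfl
  have h1 : inner ℝ (gs d p.rev) (gs b p) = (1 : ℝ) := by
    have h2 := sub_gs_mem_span d p.rev
    have h3 := sub_gs_mem_span b p
    have h4 : inner ℝ (d p.rev - gs d p.rev) (gs b p) = (0 : ℝ) :=
      inner_eq_zero_of_isReverseDual hd h2 hgs
    have h5 : inner ℝ (d p.rev) (b p - gs b p) = (0 : ℝ) := by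
      refine inner_eq_zero_of_mem_span (S := {d p.rev}) ?_ (Submodule.mem_span_singleton_self _) h3
      rintro _ rfl _ ⟨j, hj, rfl⟩
      rw [hd.2, if_neg]
      intro h
      exact (ne_of_lt hj) (Fin.rev_injective h).symm
    have h6 : inner ℝ (d p.rev) (b p) = (1 : ℝ) := by rw [hd.2, if_pos rfl]
    rw [inner_sub_left] at h4
    rw [inner_sub_right] at h5
    linarith
  have hpos : 0 < ‖gs b p‖ := norm_pos_iff.2 (gs_ne_zero hb p)
  have h7 : 1 / ‖gs b p‖ ≤ ‖gs d p.rev‖ := by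
    rw [div_le_iff₀ hpos, ← h1]
    exact real_inner_le_norm _ _
  refine h7.trans ((hH.norm_gs p.rev).2 ⟨y, ?_, hy0, rfl⟩)
  choose! z hz using hint
  set W := Submodule.span ℝ (d '' Set.Iio p.rev) with hW
  -- Only the coefficients of `y` at indices from `p.rev` on are known to be integers; the others
  -- belong to `W`, which the projection kills.
  refine ⟨∑ l ∈ Finset.Ici p.rev, z l.rev • d l, ?_, ?_⟩
  · exact Submodule.sum_mem _ fun l _ => Submodule.smul_mem _ _ (Submodule.subset_span ⟨l, rfl⟩)
  · have h8 : y - ∑ l ∈ Finset.Ici p.rev, z l.rev • d l =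
        ∑ l ∈ Finset.Iio p.rev, (inner ℝ y (b l.rev) : ℝ) • d l := by
      conv_lhs => rw [eq_sum_inner_smul_reverseDual hb hd y]
      have h9 : (Finset.univ : Finset (Fin n)) = (Finset.Ici p.rev).disjUnion (Finset.Iio p.rev)
          (Finset.disjoint_left.2 fun j hj hj' =>
            absurd (Finset.mem_Iio.1 hj') (Finset.mem_Ici.1 hj).not_gt) := by
        ext j
        simpa using le_or_gt p.rev j
      rw [h9, Finset.sum_disjUnion, add_comm, add_sub_assoc, ← Finset.sum_sub_distrib,
        add_eq_left]
      refine Finset.sum_eq_zero fun l hl => ?_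
      rw [hz l.rev (by rw [Fin.rev_le_iff]; exact Finset.mem_Ici.1 hl), Int.cast_smul_eq_zsmul,
        sub_self]
    have h10 : y - ∑ l ∈ Finset.Ici p.rev, z l.rev • d l ∈ W := by
      rw [h8]
      exact Submodule.sum_mem _ fun l hl => Submodule.smul_mem _ _
        (Submodule.subset_span ⟨l, Finset.mem_Iio.1 hl, rfl⟩)
    have h11 : y ∈ Wᗮ := (Submodule.mem_orthogonal _ _).2 fun w hw =>
      inner_eq_zero_of_isReverseDual hd hw hy
    have h12 := Submodule.starProjection_orthogonal_apply_eq_zero h10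
    rw [map_sub, Submodule.starProjection_eq_self_iff.2 h11, sub_eq_zero] at h12
    exact h12.symm

/-- Rounding the last coefficient of a vector in the span of `b_1, …, b_k`. -/
theorem exists_int_smul_add_eq {n m : ℕ} (b : Fin m → EuclideanSpace ℝ (Fin n)) {k : Fin m}
    {u : EuclideanSpace ℝ (Fin n)} (hu : u ∈ Submodule.span ℝ (b '' Set.Iic k)) :
    ∃ (z : ℤ) (a : ℝ) (w : EuclideanSpace ℝ (Fin n)), a ^ 2 ≤ 1 / 4 ∧
      w ∈ Submodule.span ℝ (b '' Set.Iio k) ∧ z • b k + u = a • gs b k + w := by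
  rw [image_Iic_eq_insert, Submodule.mem_span_insert] at hu
  obtain ⟨c, v, hv, rfl⟩ := hu
  refine ⟨-round c, c - round c, (c - round c) • (b k - gs b k) + v, ?_, ?_, ?_⟩
  · rw [← sq_abs]
    nlinarith [abs_sub_round c, abs_nonneg (c - round c)]
  · exact Submodule.add_mem _ (Submodule.smul_mem _ _ (sub_gs_mem_span b k)) hv
  · rw [← Int.cast_smul_eq_zsmul ℝ]
    push_cast
    module

theorem norm_smul_gs_add_sq {n m : ℕ} (b : Fin m → EuclideanSpace ℝ (Fin n)) {k : Fin m} (a : ℝ)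
    {w : EuclideanSpace ℝ (Fin n)} (hw : w ∈ Submodule.span ℝ (b '' Set.Iio k)) :
    ‖a • gs b k + w‖ ^ 2 = a ^ 2 * ‖gs b k‖ ^ 2 + ‖w‖ ^ 2 := by
  rw [norm_add_sq_real, inner_smul_left, inner_gs_eq_zero_of_mem b hw, norm_smul, mul_pow,
    Real.norm_eq_abs, sq_abs]
  ring

theorem zsmul_mem_lattice {n m : ℕ} (b : Fin m → EuclideanSpace ℝ (Fin n)) (k : Fin m) (z : ℤ) :
    z • b k ∈ lattice b :=
  Submodule.smul_mem _ _ (Submodule.subset_span (Set.mem_range_self k))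

theorem zsmul_mem_span_Iic {n m : ℕ} (b : Fin m → EuclideanSpace ℝ (Fin n)) (k : Fin m) (z : ℤ) :
    z • b k ∈ Submodule.span ℝ (b '' Set.Iic k) := by
  rw [← Int.cast_smul_eq_zsmul ℝ]
  exact Submodule.smul_mem _ _ (Submodule.subset_span (Set.mem_image_of_mem b Set.self_mem_Iic))

theorem latVec_mem_lattice {n m : ℕ} (b : Fin m → EuclideanSpace ℝ (Fin n)) (p : Fin m)
    (z : Set.Iic p → ℤ) : latVec (fun j : Set.Iic p => b j) z ∈ lattice b :=
  Submodule.sum_mem _ fun j _ => by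
    rw [Int.cast_smul_eq_zsmul]
    exact zsmul_mem_lattice b j _

theorem latVec_mem_span_Iic {n m : ℕ} (b : Fin m → EuclideanSpace ℝ (Fin n)) (p : Fin m)
    (z : Set.Iic p → ℤ) :
    latVec (fun j : Set.Iic p => b j) z ∈ Submodule.span ℝ (b '' Set.Iic p) :=
  Submodule.sum_mem _ fun j _ => Submodule.smul_mem _ _ (Submodule.subset_span ⟨j, j.2, rfl⟩)

/-- The covering radius of the lattice generated by an initial segment of a dual HKZ-basis. -/
theorem exists_norm_add_sq_le {n : ℕ} {b d : Fin n → EuclideanSpace ℝ (Fin n)}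
    (hb : LinearIndependent ℝ b) (hd : IsReverseDual b d) (hH : IsHKZ d) (p : Fin n)
    {u : EuclideanSpace ℝ (Fin n)} (hu : u ∈ Submodule.span ℝ (b '' Set.Iic p)) :
    ∃ x ∈ lattice b, x ∈ Submodule.span ℝ (b '' Set.Iic p) ∧
      ‖x + u‖ ^ 2 ≤ idx p ^ 2 / 4 * ‖gs b p‖ ^ 2 := by
  have hpos : 0 < ‖gs b p‖ := norm_pos_iff.2 (gs_ne_zero hb p)
  -- Transference needs dimension at least two; in dimension one, rounding gives the factor `1 / 4 =
  -- idx p ^ 2 / 4`.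
  rcases Nat.eq_zero_or_pos (p : ℕ) with hp | hp
  · obtain ⟨z, a, w, ha, hw, h⟩ := exists_int_smul_add_eq b hu
    have hI : Set.Iio p = ∅ := by
      ext j
      simp [Fin.lt_def, hp]
    have hw0 : w = 0 := by simpa [hI] using hw
    refine ⟨z • b p, zsmul_mem_lattice b p z,
      zsmul_mem_span_Iic b p z, ?_⟩
    rw [h, hw0, add_zero, norm_smul, mul_pow, Real.norm_eq_abs, sq_abs, idx, hp]
    have := mul_le_mul_of_nonneg_right ha (sq_nonneg ‖gs b p‖)
    norm_num
    linarith
  · set b' : Set.Iic p → EuclideanSpace ℝ (Fin n) := fun j => b j with hb'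
    have hli : LinearIndependent ℝ b' := hb.comp _ Subtype.coe_injective
    have hrange : Set.range b' = b '' Set.Iic p := Set.image_eq_range b (Set.Iic p) |>.symm
    rw [← hrange] at hu ⊢
    let B := Module.Basis.span hli
    have hB : ∀ j, ((B j : Submodule.span ℝ (Set.range b')) : EuclideanSpace ℝ (Fin n)) = b' j :=
      fun j => congrArg Subtype.val (Module.Basis.span_apply hli j)
    have hcard : Fintype.card (Set.Iic p) = (p : ℕ) + 1 := by simp
    obtain ⟨z, hz⟩ := exists_norm_latVec_add_lt B (by omega) (r := 1 / ‖gs b p‖) (by positivity)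
      (by
        intro y hy hint
        refine one_div_norm_gs_le hb hd hH p (hrange ▸ y.2) (by simpa using hy) fun j hj => ?_
        obtain ⟨z, hz⟩ := hint ⟨j, hj⟩
        refine ⟨z, ?_⟩
        rw [← hz, Submodule.coe_inner, hB]
        rfl) ⟨u, hu⟩
    have hlat : ((latVec B z : Submodule.span ℝ (Set.range b')) : EuclideanSpace ℝ (Fin n)) =
        latVec b' z := by
      simp [latVec, hB]
    rw [hcard, Submodule.coe_norm, Submodule.coe_add, hlat] at hz
    refine ⟨latVec b' z, latVec_mem_lattice b p z, hrange ▸ latVec_mem_span_Iic b p z, ?_⟩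
    have h1 : ‖latVec b' z + u‖ ≤ idx p / 2 * ‖gs b p‖ := by
      refine hz.le.trans_eq ?_
      rw [idx]
      push_cast
      field_simp
    calc ‖latVec b' z + u‖ ^ 2 ≤ (idx p / 2 * ‖gs b p‖) ^ 2 :=
          pow_le_pow_left₀ (norm_nonneg _) h1 2
      _ = _ := by ring

/-- Rounding the coefficients from `k` down to `p + 1`, then covering with `b_1, …, b_p`. -/
theorem exists_norm_add_sq_le_sum {n : ℕ} {b d : Fin n → EuclideanSpace ℝ (Fin n)}
    (hb : LinearIndependent ℝ b) (hd : IsReverseDual b d) (hH : IsHKZ d) (p : Fin n) :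
    ∀ (m : ℕ) (k : Fin n), (k : ℕ) = p + m → ∀ u ∈ Submodule.span ℝ (b '' Set.Iic k),
    ∃ x ∈ lattice b, x ∈ Submodule.span ℝ (b '' Set.Iic k) ∧ ‖x + u‖ ^ 2 ≤
      idx p ^ 2 / 4 * ‖gs b p‖ ^ 2 + 1 / 4 * ∑ j ∈ Finset.Ioc p k, ‖gs b j‖ ^ 2 := by
  intro m
  induction m with
  | zero =>
    intro k hk u hu
    obtain rfl : k = p := Fin.ext (by simpa using hk)
    simpa using exists_norm_add_sq_le hb hd hH k hu
  | succ m ih =>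
    intro k hk u hu
    obtain ⟨q, hq⟩ : ∃ q : Fin n, (q : ℕ) = p + m := ⟨⟨p + m, by omega⟩, rfl⟩
    have hIio : Set.Iio k = Set.Iic q := by
      ext j
      simp only [Set.mem_Iio, Set.mem_Iic, Fin.lt_def, Fin.le_def]
      omega
    have hIoc : Finset.Ioc p k = insert k (Finset.Ioc p q) := by
      ext j
      simp only [Finset.mem_Ioc, Finset.mem_insert, Fin.lt_def, Fin.le_def, Fin.ext_iff]
      omega
    have hkn : k ∉ Finset.Ioc p q := by
      simp only [Finset.mem_Ioc, Fin.le_def]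
      omega
    obtain ⟨z, a, w, ha, hw, h⟩ := exists_int_smul_add_eq b hu
    -- The remainder `w` is orthogonal to `gs b k`, so the two errors add in squares.
    obtain ⟨x, hx, hxs, hxn⟩ := ih q hq w (hIio ▸ hw)
    rw [← hIio] at hxs
    refine ⟨x + z • b k, Submodule.add_mem _ hx (zsmul_mem_lattice b k z), Submodule.add_mem _
      (Submodule.span_mono (Set.image_mono Set.Iio_subset_Iic_self) hxs)
      (zsmul_mem_span_Iic b k z), ?_⟩
    have h1 : x + z • b k + u = a • gs b k + (x + w) := by
      rw [add_assoc, h]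
      abel
    rw [h1, norm_smul_gs_add_sq b a (Submodule.add_mem _ hxs hw), hIoc, Finset.sum_insert hkn]
    have := mul_le_mul_of_nonneg_right ha (sq_nonneg ‖gs b k‖)
    linarith

theorem norm_sum_smul_gs_sq {n m : ℕ} (b : Fin m → EuclideanSpace ℝ (Fin n)) (e : Fin m → ℝ)
    (s : Finset (Fin m)) :
    ‖∑ j ∈ s, e j • gs b j‖ ^ 2 = ∑ j ∈ s, e j ^ 2 * ‖gs b j‖ ^ 2 := by
  have h : ∀ i j, i ≠ j → inner ℝ (gs b i) (gs b j) = (0 : ℝ) := fun i j hij =>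
    InnerProductSpace.gramSchmidt_orthogonal ℝ b hij
  rw [← real_inner_self_eq_norm_sq, sum_inner]
  refine Finset.sum_congr rfl fun i hi => ?_
  rw [inner_sum, Finset.sum_eq_single_of_mem i hi]
  · rw [inner_smul_left, inner_smul_right, real_inner_self_eq_norm_sq]
    simp only [conj_trivial]
    ring
  · intro j _ hj
    rw [inner_smul_left, inner_smul_right, h i j hj.symm]
    simp

theorem inner_gs_eq_zero_of_mem_Iic {n m : ℕ} (b : Fin m → EuclideanSpace ℝ (Fin n)) {k j : Fin m}
    (hkj : k < j) {x : EuclideanSpace ℝ (Fin n)} (hx : x ∈ Submodule.span ℝ (b '' Set.Iic k)) :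
    inner ℝ x (gs b j) = (0 : ℝ) := by
  rw [real_inner_comm]
  exact inner_gs_eq_zero_of_mem b (Submodule.span_mono (Set.image_mono (Set.Iic_subset_Iio.2 hkj)) hx)

/-- The competitor `v - x`, with `x` in the span of `b_1, …, b_k`, leaves the error components
beyond `k` unchanged, so minimality compares only the first `k` components. -/
theorem sum_sq_le_of_isClosestVector {n : ℕ} {b d : Fin n → EuclideanSpace ℝ (Fin n)}
    (hb : LinearIndependent ℝ b) (hd : IsReverseDual b d) (hH : IsHKZ d)
    {t v : EuclideanSpace ℝ (Fin n)} (hv : IsClosestVector (lattice b) t v)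
    {e : Fin n → ℝ} (he : t - v = ∑ j, e j • gs b j) {p k : Fin n} (hpk : p ≤ k) :
    ∑ j ∈ Finset.Iic k, e j ^ 2 * ‖gs b j‖ ^ 2 ≤
      idx p ^ 2 / 4 * ‖gs b p‖ ^ 2 + 1 / 4 * ∑ j ∈ Finset.Ioc p k, ‖gs b j‖ ^ 2 := by
  set u := ∑ j ∈ Finset.Iic k, e j • gs b j with hu
  set r := ∑ j ∈ Finset.Ioi k, e j • gs b j with hr
  have hur : t - v = u + r := by
    rw [he, hu, hr, ← Finset.sum_disjUnion (Finset.disjoint_left.2 fun j hj hj' =>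
      absurd (Finset.mem_Ioi.1 hj') (Finset.mem_Iic.1 hj).not_gt)]
    refine Finset.sum_congr ?_ fun _ _ => rfl
    ext j
    simpa using le_or_gt j k
  have huk : u ∈ Submodule.span ℝ (b '' Set.Iic k) := Submodule.sum_mem _ fun j hj =>
    Submodule.smul_mem _ _ (gs_mem_span_Iic b (Finset.mem_Iic.1 hj))
  obtain ⟨x, hx, hxs, hxn⟩ := exists_norm_add_sq_le_sum hb hd hH p (k - p) k
    (by rw [Fin.le_def] at hpk; omega) u huk
  rw [← norm_sum_smul_gs_sq]
  refine le_trans ?_ hxn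
  have horth : ∀ y ∈ Submodule.span ℝ (b '' Set.Iic k), ‖y + r‖ ^ 2 = ‖y‖ ^ 2 + ‖r‖ ^ 2 := by
    intro y hy
    have : inner ℝ y r = (0 : ℝ) := by
      rw [hr, inner_sum]
      refine Finset.sum_eq_zero fun j hj => ?_
      rw [inner_smul_right, inner_gs_eq_zero_of_mem_Iic b (Finset.mem_Ioi.1 hj) hy, mul_zero]
    rw [norm_add_sq_real, this]
    ring
  have h1 := hv.2 (v - x) (Submodule.sub_mem _ hv.1 hx)
  rw [norm_sub_rev v t, norm_sub_rev (v - x) t, hur,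
    show t - (v - x) = x + u + r by rw [add_assoc, ← hur]; abel] at h1
  have h2 := pow_le_pow_left₀ (norm_nonneg _) h1 2
  rw [horth u huk, horth _ (Submodule.add_mem _ hxs huk)] at h2
  linarith

end DualHKZ

theorem mainTheorem6 (n : ℕ) (b : Fin n → EuclideanSpace ℝ (Fin n))
    (hb : DualHKZ.IsDualHKZ b)
    (t v : EuclideanSpace ℝ (Fin n))
    (hv : DualHKZ.IsClosestVector (DualHKZ.lattice b) t v)
    (e : Fin n → ℝ) (he : t - v = ∑ j, e j • DualHKZ.gs b j)
    (i k : Fin n) (hik : i < k)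
    (hlarge : ∀ j ∈ Finset.Ioc i k, 1 / 2 < |e j|) :
    (∀ j ∈ Finset.Ioc i k, 0 < DualHKZ.weight i j) ∧ 0 < DualHKZ.bound i k ∧
      e i ^ 2 + ∑ j ∈ Finset.Ioc i k, e j ^ 2 * DualHKZ.weight i j ≤ DualHKZ.bound i k := by
  refine ⟨fun j _ => DualHKZ.weight_pos i j, DualHKZ.bound_pos i k, ?_⟩
  obtain ⟨hli, d, hd, hH⟩ := hb
  have h := DualHKZ.le_slack_of_covering (ε := fun j => e j ^ 2)
    (β := fun j => ‖DualHKZ.gs b j‖ ^ 2) (fun j => sq_nonneg _)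
    (fun j => by have := norm_pos_iff.2 (DualHKZ.gs_ne_zero hli j); positivity) hik.le
    (fun j hj => by
      rw [← sq_abs]
      nlinarith [hlarge j hj])
    fun p _ hpk => DualHKZ.sum_sq_le_of_isClosestVector hli hd hH hv he hpk
  rw [DualHKZ.slack] at h
  linarith
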